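/- Let $\rho=\frac{\sqrt5-1}{2}$ be the inverse of the golden mean, let $\frac12<p<1$, and consider the iterated function system $S_0(x)=\rho x$, $S_1(x)=\rho x+1-\rho$ on $\mathbb{R}$. There is a unique Borel probability measure $\mu$ on $\mathbb{R}$ with $$\mu(E)=p\,\mu(S_0^{-1}(E))+(1-p)\,\mu(S_1^{-1}(E))\quad\text{for all Borel }E\subseteq\mathbb{R}$$ (the biased Bernoulli convolution). For $\delta>0$ let $\overline{\dim}_{\Phi_\delta}\mu\in[0,\infty]$ be the infimum of all real $\alpha$ for which there are $C_1,C_2>0$ such that $$\frac{\mu(B(x,R))}{\mu(B(x,r))}\le C_2\left(\frac Rr\right)^{\alpha}\quad\text{for all }x\in\operatorname{supp}\mu\text{ and all }0<r<R^{1+\delta}\le R\le C_1,\ R<1,$$ with $\inf\emptyset=\infty$, where $B(x,R)$ is the open ball, and let $\dim_{qA}\mu=\lim_{\theta\to1^-}\overline{\dim}_{\Phi_{1/\theta-1}}\mu$ be the (upper) quasi-Assouad dimension of $\mu$. Then: 1. $\mu$ is an equicontractive self-similar measure of finite type, that is, both maps have the form $x\mapsto \rho x+d$, and there is a finite set $F\subseteq\mathbb{R}$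 such that, for all $n\ge 0$ and all words $v,w$ of length $n$ on $\{0,1\}$, either $|S_v(0)-S_w(0)|>c\rho^n$ or $\rho^{-n}|S_v(0)-S_w(0)|\in F$, where $S_w=S_{j_1}\circ\cdots\circ S_{j_n}$ for $w=(j_1,\dots,j_n)$ and $c$ is the diameter of the self-similar set (the non-empty compact $K$ with $K=S_0(K)\cup S_1(K)$); 2. $\operatorname{supp}\mu=[0,1]$; 3. for every $\delta>0$, $$\frac{\log\left(p/(1-p)\right)}{2\delta|\log\rho|}\le\overline{\dim}_{\Phi_\delta}\mu<\infty;$$ 4. nevertheless $\dim_{qA}\mu=\infty$. -/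

import Mathlib

open Set Filter Topology MeasureTheory

noncomputable section

namespace BernoulliConv

section Dimensions

/-- A dimension function: a map `Φ : (0,1) → [0,∞)` such that `x ^ (1 + Φ x)` decreases to `0`
as `x` decreases to `0`.  (Only the values of `Φ` on `(0,1)` matter.) -/
structure IsDimensionFunction (Φ : ℝ → ℝ) : Prop where
  nonneg : ∀ x ∈ Ioo (0 : ℝ) 1, 0 ≤ Φ x
  mono : MonotoneOn (fun x => x ^ (1 + Φ x)) (Ioo (0 : ℝ) 1)
  tendsto : Tendsto (fun x => x ^ (1 + Φ x)) (𝓝[>] (0 : ℝ)) (𝓝 0)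

/-- Non-negative constants are dimension functions. -/
theorem isDimensionFunction_const {δ : ℝ} (hδ : 0 ≤ δ) : IsDimensionFunction (fun _ => δ) where
  nonneg := fun _ _ => hδ
  mono := fun _ hx _ _ hxy => Real.rpow_le_rpow hx.1.le hxy (by linarith)
  tendsto := by
    have h : ContinuousAt (fun x : ℝ => x ^ (1 + δ)) 0 :=
      Real.continuousAt_rpow_const _ _ (Or.inr (by linarith))
    have h' := h.tendsto
    rw [Real.zero_rpow (by linarith)] at h'
    exact h'.mono_left nhdsWithin_le_nhds

variable {X : Type*} [PseudoMetricSpace X] [MeasurableSpace X]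

/-- The set of exponents `α` for which there are `C₁, C₂ > 0` such that
`μ(B(x,R)) / μ(B(x,r)) ≤ C₂ (R/r)^α` for all `x ∈ supp μ` and all
`0 < r < R^(1+Φ(R)) ≤ R ≤ C₁` (with `R` in the domain `(0,1)` of `Φ`). -/
def upperPhiExponents (Φ : ℝ → ℝ) (μ : Measure X) : Set ℝ :=
  {α | ∃ C₁ > (0 : ℝ), ∃ C₂ > (0 : ℝ), ∀ R ∈ Ioo (0 : ℝ) 1, ∀ r : ℝ,
    0 < r → r < R ^ (1 + Φ R) → R ^ (1 + Φ R) ≤ R → R ≤ C₁ →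
      ∀ x ∈ μ.support,
        μ.real (Metric.ball x R) / μ.real (Metric.ball x r) ≤ C₂ * (R / r) ^ α}

/-- The upper `Φ`-dimension of a (Borel probability) measure; it is `⊤` if there is no
admissible exponent. -/
def upperPhiDim (Φ : ℝ → ℝ) (μ : Measure X) : EReal :=
  sInf ((fun α : ℝ => (α : EReal)) '' upperPhiExponents Φ μ)

/-- `d` is the (upper) quasi-Assouad dimension of `μ`: the limit as `θ → 1` from below of the
upper `Φ_θ`-dimensions, where `Φ_θ` is the constant function `1/θ - 1`. -/
def HasQuasiAssouadDim (μ : Measure X) (d : EReal) : Prop :=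
  Tendsto (fun θ : ℝ => upperPhiDim (fun _ => 1 / θ - 1) μ) (𝓝[<] (1 : ℝ)) (𝓝 d)

end Dimensions

section SelfSimilar

variable {ι : Type*} [Fintype ι]

/-- `μ` is a self-similar measure of the iterated function system `S` of contracting similarities
of the real line with (positive) probabilities `P`. -/
structure IsSelfSimilarMeasure (S : ι → ℝ → ℝ) (P : ι → ℝ) (μ : Measure ℝ) : Prop where
  similarity : ∀ j, ∃ r ∈ Ioo (0 : ℝ) 1, ∀ x y, dist (S j x) (S j y) = r * dist x y
  prob_pos : ∀ j, 0 < P j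
  prob_sum : ∑ j, P j = 1
  isProbabilityMeasure : IsProbabilityMeasure μ
  invariant : ∀ E : Set ℝ, MeasurableSet E → μ E = ∑ j, ENNReal.ofReal (P j) * μ (S j ⁻¹' E)

/-- The maps of `S` are similarities `x ↦ r x + d` with the common factor `r ∈ (0,1)`. -/
def IsEquicontractive (S : ι → ℝ → ℝ) (r : ℝ) : Prop :=
  r ∈ Ioo (0 : ℝ) 1 ∧ ∀ j, ∃ d : ℝ, ∀ x, S j x = r * x + d

/-- `K` is the self-similar set of `S`. -/
def IsSelfSimilarSet (S : ι → ℝ → ℝ) (K : Set ℝ) : Prop :=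
  K.Nonempty ∧ IsCompact K ∧ K = ⋃ j, S j '' K

/-- The map `S_w = S_{j₁} ∘ ⋯ ∘ S_{jₙ}` of a word `w = (j₁, …, jₙ)`. -/
def wordMap (S : ι → ℝ → ℝ) (w : List ι) : ℝ → ℝ :=
  w.foldr (fun j f => S j ∘ f) id

/-- The equicontractive system `S` with contraction factor `r` is of finite type: there is a
finite set `F` such that for words `v, w` of length `n`, either
`|S_v(0) - S_w(0)| > c r^n` or `r^{-n} |S_v(0) - S_w(0)| ∈ F`, where `c` is the diameter of the
self-similar set. -/
def IsFiniteType (S : ι → ℝ → ℝ) (r : ℝ) : Prop :=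
  IsEquicontractive S r ∧ ∃ K : Set ℝ, IsSelfSimilarSet S K ∧
    ∃ F : Set ℝ, F.Finite ∧ ∀ (n : ℕ) (v w : List ι), v.length = n → w.length = n →
      Metric.diam K * r ^ n < |wordMap S v 0 - wordMap S w 0| ∨
        (r ^ n)⁻¹ * |wordMap S v 0 - wordMap S w 0| ∈ F

end SelfSimilar

/-- The inverse of the golden mean. -/
def rho : ℝ := Real.goldenRatio⁻¹

/-- The iterated function system `{ρ x, ρ x + 1 - ρ}`. -/
def goldenIFS : Fin 2 → ℝ → ℝ :=
  ![fun x => rho * x, fun x => rho * x + 1 - rho]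

/-- The probabilities `p, 1 - p`. -/
def biasedProb (p : ℝ) : Fin 2 → ℝ := ![p, 1 - p]

end BernoulliConv

end

/-!
The law of the random limit point of `S_{j₁} ∘ S_{j₂} ∘ ⋯`, with independent letters of law `P`, is
the only self-similar measure. The golden ratio is a Pisot number, so the rescaled differences
`ρ⁻ⁿ (S_v(0) - S_w(0))` are, up to the factor `1 - ρ`, algebraic integers in a fixed field whose
other conjugates are uniformly bounded; those of bounded size form a finite set. Every
self-similar measure gives a ball of radius `r` around a point of its support mass at least
`c r ^ s`; since `r < R ^ (1 + δ)` means `1 / r ≤ (R / r) ^ ((1 + δ) / δ)`, its `Φ_δ`-dimension is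
finite.

For the lower bound look at the point `ρ² = S₁(0)`. The word `1 0 0 ⋯ 0` puts mass at least
`(1 - p) p ^ (2 m)` on the interval of length `ρ ^ (2 m + 1)` to the right of `ρ²`. An address of a
point slightly to the left of `ρ²` starts with `0 1`, leading back to the left of `ρ²` at a scale
larger by `ρ⁻²`, or with `0 0`, leading to the left of `1`, where the mass is at most
`(1 - p) ^ (2 m)`; so the mass there is only `O((p (1 - p)) ^ m)`. Two concentric balls near `ρ²`
with a bounded ratio of radii thus have masses in ratio `(p / (1 - p)) ^ m`. Shrinking the inner
radius below `R ^ (1 + δ)` makes the pair admissible while `R / r` is of order `R ^ (-δ)`, with `R`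
comparable to `ρ ^ (2 m)`.
-/

namespace BernoulliConv

open Asymptotics

lemma le_of_eventually_mul_pow_le {a b c C : ℝ} (hb : 0 ≤ b) (hc : 0 < c)
    (h : ∀ᶠ m : ℕ in atTop, c * a ^ m ≤ C * b ^ m) : a ≤ b := by
  by_contra! hba
  have hlittle : (fun m : ℕ => C * b ^ m) =o[atTop] fun m => a ^ m :=
    (isLittleO_pow_pow_of_lt_left hb hba).const_mul_left C
  obtain ⟨m, hm, hm'⟩ := (h.and (hlittle.bound (half_pos hc))).exists
  have ham : 0 < a ^ m := pow_pos (hb.trans_lt hba) m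
  rw [Real.norm_of_nonneg ham.le] at hm'
  nlinarith [Real.le_norm_self (C * b ^ m)]

lemma le_mul_pow_of_succ_le {u : ℕ → ℝ} {b κ l : ℝ} (hb : 0 ≤ b) (hκ : 0 ≤ κ) (hκl : κ < l)
    (hu : ∀ m, u (m + 1) ≤ b * κ ^ m + l * u m) (m : ℕ) :
    u m ≤ (u 0 + b / (l - κ)) * l ^ m := by
  have hlκ : 0 < l - κ := sub_pos.2 hκl
  suffices key : u m ≤ (u 0 + b / (l - κ)) * l ^ m - b / (l - κ) * κ ^ m from
    key.trans (sub_le_self _ (by positivity))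
  induction m with
  | zero => simp
  | succ m ih =>
    calc u (m + 1) ≤ b * κ ^ m + l * u m := hu m
      _ ≤ b * κ ^ m + l * ((u 0 + b / (l - κ)) * l ^ m - b / (l - κ) * κ ^ m) := by
        gcongr
        exact hκ.trans hκl.le
      _ = (u 0 + b / (l - κ)) * l ^ (m + 1) - b / (l - κ) * κ ^ (m + 1) := by
        field_simp
        ring

section PhiDimension

variable {X : Type*} [PseudoMetricSpace X] [MeasurableSpace X] {μ : Measure X} {δ : ℝ}

lemma measureReal_ball_pos [IsFiniteMeasure μ] {x : X} {r : ℝ} (hx : x ∈ μ.support)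
    (hr : 0 < r) : 0 < μ.real (Metric.ball x r) :=
  ENNReal.toReal_pos (Metric.nhds_basis_ball.mem_measureSupport.1 hx r hr).ne'
    (measure_ne_top _ _)

lemma rpow_neg_le_div_rpow {r R s : ℝ} (hr : 0 < r) (hs : 0 ≤ s) (hδ : 0 < δ) (hR : 0 ≤ R)
    (hrR : r ≤ R ^ (1 + δ)) : r ^ (-s) ≤ (R / r) ^ (s * (1 + δ) / δ) := by
  have hroot : r ^ (1 / (1 + δ)) ≤ R := by
    calc r ^ (1 / (1 + δ)) ≤ (R ^ (1 + δ)) ^ (1 / (1 + δ)) := by gcongr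
      _ = R := by rw [one_div, Real.rpow_rpow_inv hR (by positivity)]
  calc r ^ (-s) = (r ^ (1 / (1 + δ) - 1)) ^ (s * (1 + δ) / δ) := by
        rw [← Real.rpow_mul hr.le]
        congr 1
        field_simp
        ring
    _ ≤ (R / r) ^ (s * (1 + δ) / δ) := by
        rw [Real.rpow_sub_one hr.ne']
        gcongr

theorem mul_div_mem_upperPhiExponents_const [IsFiniteMeasure μ] {c s : ℝ} (hc : 0 < c)
    (hs : 0 ≤ s) (hδ : 0 < δ)
    (hball : ∀ x ∈ μ.support, ∀ r ∈ Ioo (0 : ℝ) 1, c * r ^ s ≤ μ.real (Metric.ball x r)) :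
    s * (1 + δ) / δ ∈ upperPhiExponents (fun _ => δ) μ := by
  refine ⟨1, one_pos, (μ.real univ + 1) / c, by positivity,
    fun R hR r hr hrR _ _ x hx => ?_⟩
  have hr1 : r < 1 := hrR.trans (Real.rpow_lt_one hR.1.le hR.2 (by linarith))
  calc μ.real (Metric.ball x R) / μ.real (Metric.ball x r)
      ≤ (μ.real univ + 1) / (c * r ^ s) := by
        gcongr
        · linarith [measureReal_mono (μ := μ) (subset_univ (Metric.ball x R))]
        · exact hball x hx r ⟨hr, hr1⟩
    _ = (μ.real univ + 1) / c * r ^ (-s) := by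
        rw [Real.rpow_neg hr.le]
        field_simp
    _ ≤ (μ.real univ + 1) / c * (R / r) ^ (s * (1 + δ) / δ) := by
        gcongr
        exact rpow_neg_le_div_rpow hr hs hδ hR.1.le hrR.le

lemma upperPhiDim_lt_top_of_mem {Φ : ℝ → ℝ} {α : ℝ} (hα : α ∈ upperPhiExponents Φ μ) :
    upperPhiDim Φ μ < ⊤ :=
  (sInf_le (mem_image_of_mem _ hα)).trans_lt (EReal.coe_lt_top α)

section GeometricScales

variable [IsFiniteMeasure μ] {a b c κ l : ℝ} {x : ℕ → X}

lemma eventually_mul_pow_le_of_mem_upperPhiExponents (ha : 0 < a) (hb : 0 < b)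
    (hκ : κ ∈ Ioo (0 : ℝ) 1) (hδ : 0 < δ) (hc : 0 ≤ c) (hl : 0 ≤ l) (hx : ∀ m, x m ∈ μ.support)
    (hratio : ∀ m, c * l ^ m * μ.real (Metric.ball (x m) (b * κ ^ m))
      ≤ μ.real (Metric.ball (x m) (a * κ ^ m)))
    {α : ℝ} (hα : α ∈ upperPhiExponents (fun _ => δ) μ) :
    ∃ C : ℝ, ∀ᶠ m : ℕ in atTop, c * l ^ m ≤ C * (κ ^ (-(δ * α))) ^ m := by
  obtain ⟨C₁, hC₁, C₂, -, H⟩ := hα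
  have hκ0 := hκ.1
  refine ⟨C₂ * (2 * a ^ (-δ)) ^ α, ?_⟩
  have hR : Tendsto (fun m : ℕ => a * κ ^ m) atTop (𝓝 0) := by
    simpa using (tendsto_pow_atTop_nhds_zero_of_lt_one hκ0.le hκ.2).const_mul a
  have hRδ : Tendsto (fun m : ℕ => a * (a * κ ^ m) ^ δ) atTop (𝓝 0) := by
    simpa [Real.zero_rpow hδ.ne'] using (hR.rpow_const (p := δ) (Or.inr hδ.le)).const_mul a
  filter_upwards [hR.eventually_lt_const one_pos, hR.eventually_le_const hC₁,
    hRδ.eventually_le_const (by positivity : 0 < 2 * b)] with m hR1 hRC₁ hRb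
  set R := a * κ ^ m with hRdef
  have hR0 : 0 < R := by positivity
  have hRpow : R ^ (1 + δ) = R * R ^ δ := by rw [Real.rpow_add hR0, Real.rpow_one]
  have hr : R ^ (1 + δ) / 2 ≤ b * κ ^ m := by
    rw [hRpow, hRdef]
    nlinarith [pow_pos hκ0 m]
  have hquot : R / (R ^ (1 + δ) / 2) = 2 * (a ^ (-δ) * (κ ^ (-δ)) ^ m) := by
    rw [hRpow, Real.rpow_pow_comm hκ0.le, ← Real.mul_rpow ha.le (by positivity),
      ← hRdef, Real.rpow_neg hR0.le]
    field_simp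
  have hpos := measureReal_ball_pos (hx m) (half_pos (Real.rpow_pos_of_pos hR0 (1 + δ)))
  calc c * l ^ m
      ≤ μ.real (Metric.ball (x m) R) / μ.real (Metric.ball (x m) (R ^ (1 + δ) / 2)) := by
        rw [le_div_iff₀ hpos]
        refine le_trans ?_ (hratio m)
        gcongr
        exact measure_ne_top _ _
    _ ≤ C₂ * (R / (R ^ (1 + δ) / 2)) ^ α :=
        H R ⟨hR0, hR1⟩ _ (by positivity) (half_lt_self (by positivity))
          (by simpa using Real.rpow_le_rpow_of_exponent_ge hR0 hR1.le (by linarith : 1 ≤ 1 + δ))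
          hRC₁ (x m) (hx m)
    _ = C₂ * (2 * a ^ (-δ)) ^ α * (κ ^ (-(δ * α))) ^ m := by
        rw [hquot, ← mul_assoc, Real.mul_rpow (by positivity) (by positivity),
          ← Real.rpow_pow_comm (by positivity), ← Real.rpow_mul hκ0.le, neg_mul, mul_assoc]

theorem log_div_le_upperPhiDim_const (ha : 0 < a) (hb : 0 < b) (hκ : κ ∈ Ioo (0 : ℝ) 1)
    (hδ : 0 < δ) (hc : 0 < c) (hl : 0 < l) (hx : ∀ m, x m ∈ μ.support)
    (hratio : ∀ m, c * l ^ m * μ.real (Metric.ball (x m) (b * κ ^ m))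
      ≤ μ.real (Metric.ball (x m) (a * κ ^ m))) :
    ((Real.log l / (δ * |Real.log κ|) : ℝ) : EReal) ≤ upperPhiDim (fun _ => δ) μ := by
  refine le_sInf ?_
  rintro _ ⟨α, hα, rfl⟩
  obtain ⟨C, hC⟩ :=
    eventually_mul_pow_le_of_mem_upperPhiExponents ha hb hκ hδ hc.le hl.le hx hratio hα
  have hle : l ≤ κ ^ (-(δ * α)) :=
    le_of_eventually_mul_pow_le (Real.rpow_nonneg hκ.1.le _) hc hC
  have hlog : Real.log l ≤ -(δ * α) * Real.log κ :=
    (Real.log_le_log hl hle).trans_eq (Real.log_rpow hκ.1 _)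
  have hlogκ : Real.log κ < 0 := Real.log_neg hκ.1 hκ.2
  rw [EReal.coe_le_coe_iff, abs_of_neg hlogκ,
    div_le_iff₀ (mul_pos hδ (neg_pos.2 hlogκ))]
  linarith

end GeometricScales

theorem hasQuasiAssouadDim_top_of_div_le {L : ℝ} (hL : 0 < L)
    (h : ∀ δ : ℝ, 0 < δ → ((L / δ : ℝ) : EReal) ≤ upperPhiDim (fun _ => δ) μ) :
    HasQuasiAssouadDim μ ⊤ := by
  have hδ : Tendsto (fun θ : ℝ => 1 / θ - 1) (𝓝[<] 1) (𝓝[>] 0) := by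
    refine tendsto_nhdsWithin_iff.2 ⟨?_, ?_⟩
    · have : ContinuousAt (fun θ : ℝ => 1 / θ - 1) 1 := by fun_prop (disch := norm_num)
      simpa using this.tendsto.mono_left nhdsWithin_le_nhds
    · filter_upwards [Ioo_mem_nhdsLT (zero_lt_one (α := ℝ))] with θ hθ
      exact sub_pos.2 ((one_lt_div hθ.1).2 hθ.2)
  have hlim : Tendsto (fun θ : ℝ => L / (1 / θ - 1)) (𝓝[<] 1) atTop :=
    (tendsto_inv_nhdsGT_zero.comp hδ).const_mul_atTop hL
  refine EReal.tendsto_nhds_top_iff_real.2 fun M => ?_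
  filter_upwards [hlim.eventually_gt_atTop M, hδ self_mem_nhdsWithin] with θ hM hθ
  exact (EReal.coe_lt_coe_iff.2 hM).trans_le (h _ hθ)

end PhiDimension

section RandomIteration

open scoped NNReal

lemma measurePreserving_head_tail {Ω : ℕ → Type*} [∀ n, MeasurableSpace (Ω n)]
    (ν : ∀ n, Measure (Ω n)) [∀ n, IsProbabilityMeasure (ν n)] :
    MeasurePreserving (fun ω : ∀ n, Ω n => (ω 0, fun n => ω (n + 1)))
      (Measure.infinitePi ν) ((ν 0).prod (Measure.infinitePi fun n => ν (n + 1))) := by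
  have hindep : ProbabilityTheory.IndepFun (fun ω : ∀ n, Ω n => ω 0)
      (fun ω n => ω (n + 1)) (Measure.infinitePi ν) := by
    refine ProbabilityTheory.IndepFun.indepFun_process (by fun_prop) (by fun_prop) fun I => ?_
    have hfinset := (ProbabilityTheory.iIndepFun_infinitePi (P := ν) (X := fun _ a => a)
      (fun _ => measurable_id)).indepFun_finset {0} (I.map (addRightEmbedding 1)) (by simp)
      measurable_pi_apply
    have hhead : Measurable fun a : (∀ i : ({0} : Finset ℕ), Ω i) =>
        a ⟨0, Finset.mem_singleton_self 0⟩ := measurable_pi_apply _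
    have htail : Measurable fun (a : ∀ i : I.map (addRightEmbedding 1), Ω i) (i : I) =>
        a ⟨i + 1, Finset.mem_map_of_mem (addRightEmbedding 1) i.2⟩ :=
      measurable_pi_lambda _ fun _ => measurable_pi_apply _
    exact hfinset.comp hhead htail
  refine ⟨by fun_prop, ?_⟩
  rw [hindep.map_prod_eq_prod_map_map (measurable_pi_apply 0).aemeasurable
    (measurable_pi_lambda _ fun n => measurable_pi_apply (n + 1)).aemeasurable,
    Measure.infinitePi_map_eval, Measure.map_infinitePi_infinitePi_of_inj (add_left_injective 1)]

variable {ι X : Type*}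

/-- The composition `S (ω 0) ∘ ⋯ ∘ S (ω (n - 1))`, which applies the last letter first. -/
def iterateAlong (S : ι → X → X) : ℕ → (ℕ → ι) → X → X
  | 0, _, x => x
  | n + 1, ω, x => S (ω 0) (iterateAlong S n (fun k => ω (k + 1)) x)

variable {S : ι → X → X}

lemma iterateAlong_succ' (n : ℕ) (ω : ℕ → ι) (x : X) :
    iterateAlong S (n + 1) ω x = iterateAlong S n ω (S (ω n) x) := by
  induction n generalizing ω with
  | zero => rfl
  | succ n ih => exact congrArg (S (ω 0)) (ih _)

lemma iterateAlong_mem {K : Set X} (hK : ∀ j, MapsTo (S j) K K) {x : X} (hx : x ∈ K) (n : ℕ)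
    (ω : ℕ → ι) : iterateAlong S n ω x ∈ K := by
  induction n generalizing ω with
  | zero => exact hx
  | succ n ih => exact hK _ (ih _)

lemma measurable_iterateAlong [MeasurableSpace ι] [MeasurableSpace X]
    (hS : Measurable (Function.uncurry S)) (n : ℕ) :
    Measurable (Function.uncurry (iterateAlong S n)) := by
  induction n with
  | zero => exact measurable_snd
  | succ n ih =>
    have htail : Measurable fun q : (ℕ → ι) × X => ((fun k => q.1 (k + 1)), q.2) := by fun_prop
    have hhead : Measurable fun q : (ℕ → ι) × X => q.1 0 := by fun_prop
    exact hS.comp (hhead.prodMk (ih.comp htail))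

/-- `π` maps an infinite word `ω` to the limit of the compositions `S (ω 0) ∘ ⋯ ∘ S (ω (n - 1))`,
which does not depend on the starting point. -/
def IsCodingMap [TopologicalSpace X] (S : ι → X → X) (π : (ℕ → ι) → X) : Prop :=
  ∀ ω x, Tendsto (fun n => iterateAlong S n ω x) atTop (𝓝 (π ω))

/-- `μ` is the law of `S J Y` if `J` and `Y` are independent with laws `ν` and `μ`. -/
def IsStationary [MeasurableSpace ι] [MeasurableSpace X] (S : ι → X → X) (ν : Measure ι)
    (μ : Measure X) : Prop :=
  (ν.prod μ).map (Function.uncurry S) = μ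

lemma lipschitzWith_iterateAlong [PseudoEMetricSpace X] {k : ℝ≥0}
    (hS : ∀ j, LipschitzWith k (S j)) (n : ℕ) (ω : ℕ → ι) :
    LipschitzWith (k ^ n) (iterateAlong S n ω) := by
  induction n generalizing ω with
  | zero => exact (pow_zero k).symm ▸ LipschitzWith.id
  | succ n ih => exact (pow_succ' k n).symm ▸ (hS (ω 0)).comp (ih _)

theorem exists_isCodingMap [MetricSpace X] [CompleteSpace X] {k : ℝ≥0} (hk : k < 1)
    (hS : ∀ j, LipschitzWith k (S j)) {x₀ : X} {C : ℝ} (hC : ∀ j, dist x₀ (S j x₀) ≤ C) :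
    ∃ π, IsCodingMap S π := by
  have hlim : ∀ ω, ∃ y, Tendsto (fun n => iterateAlong S n ω x₀) atTop (𝓝 y) := fun ω => by
    refine cauchySeq_tendsto_of_complete
      (cauchySeq_of_le_geometric k C (mod_cast hk) fun n => ?_)
    rw [iterateAlong_succ', mul_comm]
    calc dist (iterateAlong S n ω x₀) (iterateAlong S n ω (S (ω n) x₀))
        ≤ (k ^ n : ℝ≥0) * dist x₀ (S (ω n) x₀) :=
          (lipschitzWith_iterateAlong hS n ω).dist_le_mul _ _
      _ ≤ k ^ n * C := by
          push_cast
          gcongr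
          exact hC _
  choose π hπ using hlim
  refine ⟨π, fun ω x => ?_⟩
  have hdist : Tendsto (fun n => (k : ℝ) ^ n * dist x x₀) atTop (𝓝 0) := by
    simpa using (tendsto_pow_atTop_nhds_zero_of_lt_one k.2 (mod_cast hk)).mul_const (dist x x₀)
  refine (hπ ω).congr_dist ?_
  refine squeeze_zero (fun _ => dist_nonneg) (fun n => ?_) hdist
  simpa [dist_comm] using (lipschitzWith_iterateAlong hS n ω).dist_le_mul x x₀

namespace IsCodingMap

variable {π : (ℕ → ι) → X}

lemma mem_of_isClosed [TopologicalSpace X] (hπ : IsCodingMap S π) {K : Set X} (hK : IsClosed K)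
    (hne : K.Nonempty) (hmaps : ∀ j, MapsTo (S j) K K) (ω : ℕ → ι) : π ω ∈ K := by
  obtain ⟨x, hx⟩ := hne
  exact hK.mem_of_tendsto (hπ ω x) (Eventually.of_forall fun n => iterateAlong_mem hmaps hx n ω)

lemma eq_apply_tail [TopologicalSpace X] [T2Space X] [Nonempty X] (hπ : IsCodingMap S π)
    (hS : ∀ j, Continuous (S j)) (ω : ℕ → ι) : π ω = S (ω 0) (π fun n => ω (n + 1)) := by
  inhabit X
  exact tendsto_nhds_unique ((tendsto_add_atTop_iff_nat 1).2 (hπ ω default))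
    (((hS (ω 0)).tendsto _).comp (hπ _ default))

variable [MeasurableSpace ι] [MetricSpace X] [Nonempty X] [MeasurableSpace X] [BorelSpace X]
  {ν : Measure ι} [IsProbabilityMeasure ν]

lemma measurable (hπ : IsCodingMap S π) (hS : Measurable (Function.uncurry S)) :
    Measurable π := by
  inhabit X
  exact measurable_of_tendsto_metrizable
    (fun n => (measurable_iterateAlong hS n).comp measurable_prodMk_right)
    (tendsto_pi_nhds.2 fun ω => hπ ω default)

theorem isStationary_map (hπ : IsCodingMap S π) (hcont : ∀ j, Continuous (S j))
    (hS : Measurable (Function.uncurry S)) :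
    IsStationary S ν ((Measure.infinitePi fun _ => ν).map π) := by
  have hmeas := hπ.measurable hS
  have hpres := ((MeasurePreserving.id ν).prod
    (hmeas.measurePreserving (Measure.infinitePi fun _ => ν))).comp
    (measurePreserving_head_tail fun _ => ν)
  have hπ_eq : π = Function.uncurry S ∘ Prod.map id π ∘ fun ω => (ω 0, fun n => ω (n + 1)) :=
    funext (hπ.eq_apply_tail hcont)
  rw [IsStationary, ← hpres.map_eq, Measure.map_map hS hpres.measurable]
  exact congrArg (Measure.map · _) hπ_eq.symm

end IsCodingMap

variable [MeasurableSpace ι] [MeasurableSpace X] {ν : Measure ι} [IsProbabilityMeasure ν]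
  {μ : Measure X} [IsProbabilityMeasure μ]

lemma IsStationary.measurePreserving_iterateAlong (hμ : IsStationary S ν μ)
    (hS : Measurable (Function.uncurry S)) (n : ℕ) :
    MeasurePreserving (Function.uncurry (iterateAlong S n))
      ((Measure.infinitePi fun _ => ν).prod μ) μ := by
  induction n with
  | zero => exact measurePreserving_snd
  | succ n ih =>
    exact (MeasurePreserving.mk hS hμ).comp <| ((MeasurePreserving.id ν).prod ih).comp <|
      (measurePreserving_prodAssoc ν _ μ).comp <|
      (measurePreserving_head_tail fun _ => ν).prod (MeasurePreserving.id μ)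

theorem IsStationary.map_codingMap {X : Type*} [MetricSpace X] [MeasurableSpace X] [BorelSpace X]
    {S : ι → X → X} {π : (ℕ → ι) → X} {μ : Measure X} [IsProbabilityMeasure μ]
    (hμ : IsStationary S ν μ) (hS : Measurable (Function.uncurry S)) (hπ : IsCodingMap S π) :
    (Measure.infinitePi fun _ => ν).map π = μ := by
  have : Nonempty X := μ.nonempty_of_neZero
  have hmeas := hπ.measurable hS
  have := Measure.isProbabilityMeasure_map (μ := Measure.infinitePi fun _ : ℕ => ν)
    hmeas.aemeasurable
  refine ext_of_forall_integral_eq_of_IsFiniteMeasure fun f => ?_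
  set Q := (Measure.infinitePi fun _ : ℕ => ν).prod μ
  have hconst : ∀ n, ∫ q, f (iterateAlong S n q.1 q.2) ∂Q = ∫ x, f x ∂μ := fun n => by
    have hpres := hμ.measurePreserving_iterateAlong hS n
    conv_rhs => rw [← hpres.map_eq]
    exact (integral_map hpres.aemeasurable
      f.continuous.measurable.aestronglyMeasurable).symm
  have hlim : Tendsto (fun n => ∫ q, f (iterateAlong S n q.1 q.2) ∂Q) atTop
      (𝓝 (∫ q, f (π q.1) ∂Q)) := by
    refine tendsto_integral_of_dominated_convergence (fun _ => ‖f‖)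
      (fun n => ?_) (integrable_const _) (fun n => ae_of_all _ fun q => f.norm_coe_le_norm _)
      (ae_of_all _ fun q => (f.continuous.tendsto _).comp (hπ q.1 q.2))
    exact (f.continuous.measurable.comp (measurable_iterateAlong hS n)).aestronglyMeasurable
  simp only [hconst] at hlim
  rw [integral_map hmeas.aemeasurable f.continuous.measurable.aestronglyMeasurable,
    tendsto_nhds_unique tendsto_const_nhds hlim, integral_fun_fst (fun ω => f (π ω))]
  simp

end RandomIteration

section SelfSimilarMeasure

open scoped NNReal

lemma exists_forall_lipschitzWith {ι X : Type*} [Finite ι] [PseudoEMetricSpace X] {S : ι → X → X}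
    (hS : ∀ j, ∃ k < (1 : ℝ≥0), LipschitzWith k (S j)) :
    ∃ k ∈ Ioo (0 : ℝ≥0) 1, ∀ j, LipschitzWith k (S j) := by
  have hev : ∀ᶠ k in 𝓝[<] (1 : ℝ≥0), ∀ j, LipschitzWith k (S j) := by
    refine eventually_all.2 fun j => ?_
    obtain ⟨k, hk, hlip⟩ := hS j
    filter_upwards [Ioo_mem_nhdsLT hk] with k' hk'
    exact hlip.weaken hk'.1.le
  have : (𝓝[<] (1 : ℝ≥0)).NeBot := nhdsLT_neBot_of_exists_lt ⟨0, one_pos⟩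
  exact ((eventually_mem_set.2 (Ioo_mem_nhdsLT one_pos)).and hev).exists

theorem exists_isCodingMap_of_finite {ι X : Type*} [Finite ι] [MetricSpace X] [CompleteSpace X]
    [Nonempty X] {S : ι → X → X} (hS : ∀ j, ∃ k < (1 : ℝ≥0), LipschitzWith k (S j)) :
    ∃ π, IsCodingMap S π := by
  inhabit X
  obtain ⟨k, hk, hlip⟩ := exists_forall_lipschitzWith hS
  obtain ⟨C, hC⟩ := (finite_range fun j => dist default (S j default)).bddAbove
  exact exists_isCodingMap hk.2 hlip fun j => hC (mem_range_self j)

lemma exists_lipschitzWith_of_dist_eq {X : Type*} [PseudoMetricSpace X] {f : X → X}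
    (hf : ∃ r ∈ Ioo (0 : ℝ) 1, ∀ x y, dist (f x) (f y) = r * dist x y) :
    ∃ k < (1 : ℝ≥0), LipschitzWith k f := by
  obtain ⟨r, hr, hdist⟩ := hf
  exact ⟨⟨r, hr.1.le⟩, hr.2, LipschitzWith.of_dist_le_mul fun x y => (hdist x y).le⟩

lemma exists_forall_le_of_pos {ι : Type*} [Finite ι] {P : ι → ℝ} (hP : ∀ j, 0 < P j) :
    ∃ q ∈ Ioo (0 : ℝ) 1, ∀ j, q ≤ P j := by
  have hev : ∀ᶠ q in 𝓝[>] (0 : ℝ), ∀ j, q ≤ P j := by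
    refine eventually_all.2 fun j => ?_
    filter_upwards [Ioo_mem_nhdsGT (hP j)] with q hq
    exact hq.2.le
  exact ((eventually_mem_set.2 (Ioo_mem_nhdsGT one_pos)).and hev).exists

lemma pow_length_le_prod_map {ι : Type*} {P : ι → ℝ} {q : ℝ} (hq : 0 ≤ q) (hP : ∀ j, q ≤ P j)
    (w : List ι) : q ^ w.length ≤ (w.map P).prod := by
  induction w with
  | nil => simp
  | cons j w ih =>
    rw [List.length_cons, List.map_cons, List.prod_cons, pow_succ']
    exact mul_le_mul (hP j) ih (by positivity) (hq.trans (hP j))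

lemma lipschitzWith_wordMap {ι : Type*} {S : ι → ℝ → ℝ} {k : ℝ≥0}
    (hS : ∀ j, LipschitzWith k (S j)) (w : List ι) :
    LipschitzWith (k ^ w.length) (wordMap S w) := by
  induction w with
  | nil => exact (pow_zero k).symm ▸ LipschitzWith.id
  | cons j w ih => exact (pow_succ' k w.length).symm ▸ (hS j).comp ih

lemma IsSelfSimilarSet.exists_wordMap_eq {ι : Type*} {S : ι → ℝ → ℝ} {K : Set ℝ}
    (hK : IsSelfSimilarSet S K) {x : ℝ} (hx : x ∈ K) (n : ℕ) :
    ∃ w : List ι, w.length = n ∧ ∃ y ∈ K, wordMap S w y = x := by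
  induction n generalizing x with
  | zero => exact ⟨[], rfl, x, hx, rfl⟩
  | succ n ih =>
    rw [hK.2.2] at hx
    obtain ⟨j, z, hz, rfl⟩ := mem_iUnion.1 hx
    obtain ⟨w, hw, y, hy, rfl⟩ := ih hz
    exact ⟨j :: w, congrArg (· + 1) hw, y, hy, rfl⟩

variable {ι : Type*} [Fintype ι] {S : ι → ℝ → ℝ} {P : ι → ℝ} {μ : Measure ℝ} {K : Set ℝ}

/-- The law of a random letter which equals `j` with probability `P j`. -/
noncomputable def letterLaw [MeasurableSpace ι] (P : ι → ℝ) : Measure ι :=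
  ∑ j, ENNReal.ofReal (P j) • Measure.dirac j

lemma isProbabilityMeasure_letterLaw [MeasurableSpace ι] (hP : ∀ j, 0 ≤ P j)
    (hsum : ∑ j, P j = 1) : IsProbabilityMeasure (letterLaw P) := by
  constructor
  simp [letterLaw, ← ENNReal.ofReal_sum_of_nonneg fun j _ => hP j, hsum]

lemma isStationary_letterLaw_iff [MeasurableSpace ι] [DiscreteMeasurableSpace ι] [SFinite μ]
    (hS : ∀ j, Measurable (S j)) :
    IsStationary S (letterLaw P) μ ↔
      ∀ E, MeasurableSet E → μ E = ∑ j, ENNReal.ofReal (P j) * μ (S j ⁻¹' E) := by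
  have hS' : Measurable (Function.uncurry S) := measurable_from_prod_countable_right hS
  have hmap : ∀ E, MeasurableSet E → ((letterLaw P).prod μ).map (Function.uncurry S) E
      = ∑ j, ENNReal.ofReal (P j) * μ (S j ⁻¹' E) := fun E hE => by
    rw [Measure.map_apply hS' hE, Measure.prod_apply (hS' hE), letterLaw,
      lintegral_finsetSum_measure]
    simp [preimage_preimage]
  refine ⟨fun h E hE => by rw [← hmap E hE, h], fun h => Measure.ext fun E hE => ?_⟩
  rw [hmap E hE, h E hE]

theorem existsUnique_isSelfSimilarMeasure
    (hS : ∀ j, ∃ r ∈ Ioo (0 : ℝ) 1, ∀ x y, dist (S j x) (S j y) = r * dist x y)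
    (hP : ∀ j, 0 < P j) (hsum : ∑ j, P j = 1) : ∃! μ, IsSelfSimilarMeasure S P μ := by
  let _ : MeasurableSpace ι := ⊤
  have hlip : ∀ j, ∃ k < (1 : ℝ≥0), LipschitzWith k (S j) := fun j =>
    exists_lipschitzWith_of_dist_eq (hS j)
  have hcont : ∀ j, Continuous (S j) := fun j =>
    let ⟨_, _, hk⟩ := hlip j
    hk.continuous
  have hmeas : Measurable (Function.uncurry S) :=
    measurable_from_prod_countable_right fun j => (hcont j).measurable
  have := isProbabilityMeasure_letterLaw (fun j => (hP j).le) hsum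
  obtain ⟨π, hπ⟩ := exists_isCodingMap_of_finite hlip
  have hμ := Measure.isProbabilityMeasure_map
    (μ := Measure.infinitePi fun _ => letterLaw P) (hπ.measurable hmeas).aemeasurable
  refine ⟨_, ⟨hS, hP, hsum, hμ, (isStationary_letterLaw_iff fun j => (hcont j).measurable).1
    (hπ.isStationary_map hcont hmeas)⟩, fun μ h => ?_⟩
  have := h.isProbabilityMeasure
  exact (((isStationary_letterLaw_iff fun j => (hcont j).measurable).2 h.invariant).map_codingMap
    hmeas hπ).symm

namespace IsSelfSimilarMeasure

lemma exists_lipschitzWith (h : IsSelfSimilarMeasure S P μ) :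
    ∃ k ∈ Ioo (0 : ℝ≥0) 1, ∀ j, LipschitzWith k (S j) :=
  exists_forall_lipschitzWith fun j => exists_lipschitzWith_of_dist_eq (h.similarity j)

lemma continuous (h : IsSelfSimilarMeasure S P μ) (j : ι) : Continuous (S j) :=
  let ⟨_, _, hk⟩ := h.exists_lipschitzWith
  (hk j).continuous

lemma measureReal_eq_sum (h : IsSelfSimilarMeasure S P μ) {E : Set ℝ} (hE : MeasurableSet E) :
    μ.real E = ∑ j, P j * μ.real (S j ⁻¹' E) := by
  have := h.isProbabilityMeasure
  rw [measureReal_def, h.invariant E hE, ENNReal.toReal_sum fun j _ => by finiteness]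
  exact Finset.sum_congr rfl fun j _ => by
    rw [ENNReal.toReal_mul, ENNReal.toReal_ofReal (h.prob_pos j).le, measureReal_def]

lemma measureReal_le_sum (h : IsSelfSimilarMeasure S P μ) {E : Set ℝ} (hE : MeasurableSet E)
    {A : ι → Set ℝ} (hA : ∀ j, S j ⁻¹' E ⊆ A j) : μ.real E ≤ ∑ j, P j * μ.real (A j) := by
  have := h.isProbabilityMeasure
  rw [h.measureReal_eq_sum hE]
  refine Finset.sum_le_sum fun j _ => mul_le_mul_of_nonneg_left ?_ (h.prob_pos j).le
  exact measureReal_mono (hA j)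

lemma prod_mul_measureReal_le (h : IsSelfSimilarMeasure S P μ) {w : List ι} {A E : Set ℝ}
    (hE : MeasurableSet E) (hw : MapsTo (wordMap S w) A E) :
    (w.map P).prod * μ.real A ≤ μ.real E := by
  have := h.isProbabilityMeasure
  induction w generalizing E with
  | nil => simpa using measureReal_mono hw
  | cons j w ih =>
    calc ((j :: w).map P).prod * μ.real A = P j * ((w.map P).prod * μ.real A) := by
          rw [List.map_cons, List.prod_cons, mul_assoc]
      _ ≤ P j * μ.real (S j ⁻¹' E) := by
          gcongr
          · exact (h.prob_pos j).le
          · exact ih ((h.continuous j).measurable hE) hw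
      _ ≤ ∑ i, P i * μ.real (S i ⁻¹' E) :=
          Finset.single_le_sum (f := fun i => P i * μ.real (S i ⁻¹' E))
            (fun i _ => mul_nonneg (h.prob_pos i).le measureReal_nonneg) (Finset.mem_univ j)
      _ = μ.real E := (h.measureReal_eq_sum hE).symm

lemma ae_mem (h : IsSelfSimilarMeasure S P μ) (hK : IsSelfSimilarSet S K) : K ∈ ae μ := by
  let _ : MeasurableSpace ι := ⊤
  have := h.isProbabilityMeasure
  have := isProbabilityMeasure_letterLaw (fun j => (h.prob_pos j).le) h.prob_sum
  have hmeas : Measurable (Function.uncurry S) :=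
    measurable_from_prod_countable_right fun j => (h.continuous j).measurable
  obtain ⟨π, hπ⟩ := exists_isCodingMap_of_finite fun j =>
    exists_lipschitzWith_of_dist_eq (h.similarity j)
  have hmaps : ∀ j, MapsTo (S j) K K := fun j => by
    rw [mapsTo_iff_image_subset]
    conv_rhs => rw [hK.2.2]
    exact subset_iUnion (fun j => S j '' K) j
  rw [← ((isStationary_letterLaw_iff fun j => (h.continuous j).measurable).2
    h.invariant).map_codingMap hmeas hπ]
  exact mem_ae_map_iff (hπ.measurable hmeas).aemeasurable hK.2.1.measurableSet |>.2 <|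
    Eventually.of_forall fun ω => hπ.mem_of_isClosed hK.2.1.isClosed hK.1 hmaps ω

lemma measureReal_eq_zero (h : IsSelfSimilarMeasure S P μ) (hK : IsSelfSimilarSet S K)
    {E : Set ℝ} (hE : Disjoint E K) : μ.real E = 0 := by
  rw [measureReal_def, measure_mono_null hE.subset_compl_right (h.ae_mem hK),
    ENNReal.toReal_zero]

lemma measureReal_eq_one (h : IsSelfSimilarMeasure S P μ) (hK : IsSelfSimilarSet S K) :
    μ.real K = 1 := by
  have := h.isProbabilityMeasure
  rw [measureReal_def,
    (mem_ae_iff_prob_eq_one hK.2.1.measurableSet).1 (h.ae_mem hK), ENNReal.toReal_one]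

lemma pow_le_measureReal_ball (h : IsSelfSimilarMeasure S P μ) (hK : IsSelfSimilarSet S K)
    {k : ℝ≥0} (hk : 0 < k) (hlip : ∀ j, LipschitzWith k (S j)) {q : ℝ} (hq : 0 ≤ q)
    (hqP : ∀ j, q ≤ P j) {D : ℝ} (hD : Metric.diam K < D) {x : ℝ} (hx : x ∈ K) (n : ℕ) :
    q ^ n ≤ μ.real (Metric.ball x (D * k ^ n)) := by
  obtain ⟨w, rfl, y, hy, rfl⟩ := hK.exists_wordMap_eq hx n
  refine (pow_length_le_prod_map hq hqP w).trans ?_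
  rw [← mul_one (List.prod _), ← h.measureReal_eq_one hK]
  refine h.prod_mul_measureReal_le measurableSet_ball fun z hz => ?_
  calc dist (wordMap S w z) (wordMap S w y) ≤ (k ^ w.length : ℝ≥0) * dist z y :=
        (lipschitzWith_wordMap hlip w).dist_le_mul z y
    _ < k ^ w.length * D := by
        push_cast
        gcongr
        exact (Metric.dist_le_diam_of_mem hK.2.1.isBounded hz hy).trans_lt hD
    _ = D * k ^ w.length := mul_comm _ _

theorem exists_mul_rpow_le_measureReal_ball (h : IsSelfSimilarMeasure S P μ)
    (hK : IsSelfSimilarSet S K) : ∃ c > 0, ∃ s ≥ (0 : ℝ), ∀ x ∈ K, ∀ r ∈ Ioo (0 : ℝ) 1,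
      c * r ^ s ≤ μ.real (Metric.ball x r) := by
  have := h.isProbabilityMeasure
  obtain ⟨k, hk, hlip⟩ := h.exists_lipschitzWith
  obtain ⟨q, hq, hqP⟩ := exists_forall_le_of_pos h.prob_pos
  have hk0 : (0 : ℝ) < k := hk.1
  have hk1 : (k : ℝ) < 1 := hk.2
  have hD : 0 < Metric.diam K + 1 := by positivity
  have hs : 0 ≤ Real.logb k q := (Real.logb_pos_of_base_lt_one hk0 hk1 hq.1 hq.2).le
  set D := Metric.diam K + 1
  refine ⟨q * D ^ (-Real.logb k q), mul_pos hq.1 (by positivity), _, hs, fun x hx r hr => ?_⟩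
  obtain ⟨n, hn, hn'⟩ := exists_nat_pow_near_of_lt_one (div_pos hr.1 hD)
    ((div_le_one hD).2 (hr.2.le.trans (le_add_of_nonneg_left Metric.diam_nonneg))) hk0 hk1
  calc q * D ^ (-Real.logb k q) * r ^ Real.logb k q = q * (r / D) ^ Real.logb k q := by
        rw [Real.div_rpow hr.1.le hD.le, Real.rpow_neg hD.le]
        ring
    _ ≤ q * ((k : ℝ) ^ n) ^ Real.logb k q := by
        have := hq.1.le
        have := (div_pos hr.1 hD).le
        gcongr
    _ = q ^ (n + 1) := by
        rw [← Real.rpow_pow_comm hk0.le, Real.rpow_logb hk0 hk1.ne hq.1, pow_succ']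
    _ ≤ μ.real (Metric.ball x (D * k ^ (n + 1))) :=
        h.pow_le_measureReal_ball hK hk.1 hlip hq.1.le hqP (lt_add_one _) hx _
    _ ≤ μ.real (Metric.ball x r) :=
        measureReal_mono (Metric.ball_subset_ball ((lt_div_iff₀' hD).1 hn).le)

theorem support_eq (h : IsSelfSimilarMeasure S P μ) (hK : IsSelfSimilarSet S K) :
    μ.support = K := by
  refine (Measure.support_subset_of_isClosed hK.2.1.isClosed (h.ae_mem hK)).antisymm fun x hx => ?_
  obtain ⟨c, hc, s, -, hball⟩ := h.exists_mul_rpow_le_measureReal_ball hK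
  refine (Measure.mem_support_iff_forall x).2 fun U hU => ?_
  obtain ⟨r, hr, hrU⟩ := Metric.mem_nhds_iff.1 hU
  have hr' : min r 2⁻¹ ∈ Ioo (0 : ℝ) 1 := ⟨by positivity, by norm_num⟩
  have hpos : 0 < μ.real (Metric.ball x (min r 2⁻¹)) :=
    (mul_pos hc (Real.rpow_pos_of_pos hr'.1 s)).trans_le (hball x hx _ hr')
  exact (ENNReal.toReal_pos_iff.1 hpos).1.trans_le
    (measure_mono ((Metric.ball_subset_ball (min_le_left _ _)).trans hrU))

theorem upperPhiDim_const_lt_top (h : IsSelfSimilarMeasure S P μ) (hK : IsSelfSimilarSet S K)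
    {δ : ℝ} (hδ : 0 < δ) : upperPhiDim (fun _ => δ) μ < ⊤ := by
  have := h.isProbabilityMeasure
  obtain ⟨c, hc, s, hs, hball⟩ := h.exists_mul_rpow_le_measureReal_ball hK
  rw [← h.support_eq hK] at hball
  exact upperPhiDim_lt_top_of_mem (mul_div_mem_upperPhiExponents_const hc hs hδ hball)

end IsSelfSimilarMeasure

end SelfSimilarMeasure

section Pisot

open Polynomial IntermediateField

/-- A Pisot number: an algebraic integer `β > 1` all of whose other conjugates lie in the open unit
disc. -/
structure IsPisot (β : ℝ) : Prop where
  one_lt : 1 < β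
  isIntegral : IsIntegral ℤ β
  norm_lt_one : ∀ z : ℂ, aeval z (minpoly ℤ β) = 0 → z ≠ β → ‖z‖ < 1

lemma finite_setOf_norm_conj_aeval_le {L : Type*} [Field L] [CharZero L] {β : L}
    (hβ : IsIntegral ℤ β) (B : ℝ) :
    {x | ∃ f : ℤ[X], aeval β f = x ∧
      ∀ z : ℂ, aeval z (minpoly ℤ β) = 0 → ‖aeval z f‖ ≤ B}.Finite := by
  have : FiniteDimensional ℚ ℚ⟮β⟯ := adjoin.finiteDimensional (hβ.tower_top (A := ℚ))
  have : NumberField ℚ⟮β⟯ := ⟨⟩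
  refine ((NumberField.Embeddings.finite_of_norm_le ℚ⟮β⟯ ℂ B).image (algebraMap ℚ⟮β⟯ L)).subset ?_
  rintro _ ⟨f, rfl, hf⟩
  have hgen : algebraMap ℚ⟮β⟯ L (AdjoinSimple.gen ℚ β) = β := AdjoinSimple.algebraMap_gen ℚ β
  have hinj := (algebraMap ℚ⟮β⟯ L).injective
  have hint : IsIntegral ℤ (AdjoinSimple.gen ℚ β) :=
    (isIntegral_algebraMap_iff hinj).1 (hgen.symm ▸ hβ)
  refine ⟨aeval (AdjoinSimple.gen ℚ β) f, ⟨.of_mem_of_fg _ hint.fg_adjoin_singleton _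
    (aeval_mem_adjoin_singleton ℤ _), fun φ => ?_⟩, ?_⟩
  · have hφ : ∀ g : ℤ[X], φ (aeval (AdjoinSimple.gen ℚ β) g) = aeval (φ (AdjoinSimple.gen ℚ β)) g :=
      fun g => (aeval_algHom_apply φ.toIntAlgHom _ g).symm
    rw [hφ]
    refine hf _ ?_
    rw [← hφ, (map_eq_zero φ), ← map_eq_zero_iff _ hinj, ← aeval_algebraMap_apply, hgen,
      minpoly.aeval]
  · rw [← aeval_algebraMap_apply, hgen]

variable {ι : Type*}

/-- The integer polynomial whose value at `β` is `β ^ n • S_w(0)` for words `w` of length `n` in the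
maps `S j x = β⁻¹ * x + q j (β)`. -/
noncomputable def wordPoly (q : ι → ℤ[X]) : List ι → ℤ[X]
  | [] => 0
  | j :: w => wordPoly q w + X ^ (w.length + 1) * q j

variable {q : ι → ℤ[X]}

lemma wordMap_zero_eq {S : ι → ℝ → ℝ} {β c : ℝ} (hβ : β ≠ 0)
    (hS : ∀ j x, S j x = β⁻¹ * x + c * aeval β (q j)) (w : List ι) :
    wordMap S w 0 = β⁻¹ ^ w.length * (c * aeval β (wordPoly q w)) := by
  induction w with
  | nil => simp [wordMap, wordPoly]
  | cons j w ih =>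
    have hcancel : β⁻¹ ^ (w.length + 1) * β ^ (w.length + 1) = 1 := by
      rw [← mul_pow, inv_mul_cancel₀ hβ, one_pow]
    calc wordMap S (j :: w) 0 = S j (wordMap S w 0) := rfl
      _ = β⁻¹ ^ (w.length + 1) * (c * aeval β (wordPoly q (j :: w))) := by
        rw [hS, ih, wordPoly, map_add, map_mul, map_pow, aeval_X]
        linear_combination -(c * aeval β (q j)) * hcancel

lemma one_sub_norm_mul_norm_aeval_wordPoly_le {z : ℂ} (hz : ‖z‖ < 1) {D : ℝ}
    (hD : ∀ j, ‖aeval z (q j)‖ ≤ D) (w : List ι) :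
    (1 - ‖z‖) * ‖aeval z (wordPoly q w)‖ ≤ D * (1 - ‖z‖ ^ w.length) := by
  induction w with
  | nil => simp [wordPoly]
  | cons j w ih =>
    have : 0 < 1 - ‖z‖ := sub_pos.2 hz
    have : 0 ≤ D := (norm_nonneg _).trans (hD j)
    calc (1 - ‖z‖) * ‖aeval z (wordPoly q (j :: w))‖
        ≤ (1 - ‖z‖) * (‖aeval z (wordPoly q w)‖ + ‖z‖ ^ (w.length + 1) * ‖aeval z (q j)‖) := by
          rw [wordPoly, map_add, map_mul, map_pow, aeval_X, ← norm_pow, ← norm_mul]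
          gcongr
          exact norm_add_le _ _
      _ ≤ D * (1 - ‖z‖ ^ w.length) + (1 - ‖z‖) * (‖z‖ ^ w.length * D) := by
          rw [mul_add]
          have hpow : ‖z‖ ^ (w.length + 1) ≤ ‖z‖ ^ w.length :=
            pow_le_pow_of_le_one (norm_nonneg z) hz.le (Nat.le_succ _)
          gcongr
          exact hD j
      _ = D * (1 - ‖z‖ ^ (j :: w).length) := by
          rw [List.length_cons]
          ring

lemma exists_norm_aeval_wordPoly_le [Finite ι] {z : ℂ} (hz : ‖z‖ < 1) :
    ∃ B : ℝ, ∀ w, ‖aeval z (wordPoly q w)‖ ≤ B := by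
  obtain ⟨D, hD⟩ := (finite_range fun j => ‖aeval z (q j)‖).bddAbove
  have hz' : 0 < 1 - ‖z‖ := sub_pos.2 hz
  refine ⟨|D| / (1 - ‖z‖), fun w => (le_div_iff₀' hz').2 ?_⟩
  calc (1 - ‖z‖) * ‖aeval z (wordPoly q w)‖ ≤ |D| * (1 - ‖z‖ ^ w.length) :=
        one_sub_norm_mul_norm_aeval_wordPoly_le hz
          (fun j => (hD (mem_range_self j)).trans (le_abs_self D)) w
    _ ≤ |D| := mul_le_of_le_one_right (abs_nonneg D) (sub_le_self _ (by positivity))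

lemma IsPisot.exists_norm_aeval_wordPoly_le [Finite ι] {β : ℝ} (hβ : IsPisot β)
    (q : ι → ℤ[X]) :
    ∃ B : ℝ, ∀ z : ℂ, aeval z (minpoly ℤ β) = 0 → z ≠ β →
      ∀ w, ‖aeval z (wordPoly q w)‖ ≤ B := by
  have hfin : {z : ℂ | aeval z (minpoly ℤ β) = 0 ∧ z ≠ β}.Finite :=
    ((minpoly ℤ β).rootSet_finite ℂ).subset fun z hz =>
      (mem_rootSet_of_ne (minpoly.ne_zero hβ.isIntegral)).2 hz.1
  have hev : ∀ᶠ B : ℝ in atTop, ∀ z ∈ {z : ℂ | aeval z (minpoly ℤ β) = 0 ∧ z ≠ β},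
      ∀ w, ‖aeval z (wordPoly q w)‖ ≤ B := by
    refine (eventually_all_finite hfin).2 fun z hz => ?_
    obtain ⟨B, hB⟩ :=
      BernoulliConv.exists_norm_aeval_wordPoly_le (q := q) (hβ.norm_lt_one z hz.1 hz.2)
    filter_upwards [eventually_ge_atTop B] with B' hB' w using (hB w).trans hB'
  obtain ⟨B, hB⟩ := hev.exists
  exact ⟨B, fun z hz hne => hB z ⟨hz, hne⟩⟩

theorem IsPisot.isFiniteType [Finite ι] {S : ι → ℝ → ℝ} {β c : ℝ} {K : Set ℝ} (hβ : IsPisot β)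
    (hc : c ≠ 0) (hS : ∀ j x, S j x = β⁻¹ * x + c * aeval β (q j)) (hK : IsSelfSimilarSet S K) :
    IsFiniteType S β⁻¹ := by
  have hβ0 : 0 < β := one_pos.trans hβ.one_lt
  obtain ⟨B, hB⟩ := hβ.exists_norm_aeval_wordPoly_le q
  refine ⟨⟨⟨inv_pos.2 hβ0, inv_lt_one_of_one_lt₀ hβ.one_lt⟩, fun j => ⟨_, hS j⟩⟩, K, hK,
    (fun x => |c * x|) '' _, (finite_setOf_norm_conj_aeval_le hβ.isIntegral
      (max (B + B) (Metric.diam K / |c|))).image _, fun n v w hv hw => ?_⟩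
  have hdiff : |wordMap S v 0 - wordMap S w 0|
      = β⁻¹ ^ n * |c * aeval β (wordPoly q v - wordPoly q w)| := by
    rw [wordMap_zero_eq hβ0.ne' hS, wordMap_zero_eq hβ0.ne' hS, hv, hw, ← mul_sub, ← mul_sub,
      ← map_sub, abs_mul, abs_of_pos (by positivity)]
  refine or_iff_not_imp_left.2 fun hle =>
    ⟨_, ⟨wordPoly q v - wordPoly q w, rfl, fun z hz => ?_⟩, ?_⟩
  · obtain rfl | hne := eq_or_ne z β
    · refine le_max_of_le_right ((le_div_iff₀' (abs_pos.2 hc)).2 ?_)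
      rw [hdiff, mul_comm (Metric.diam K), not_lt, mul_le_mul_iff_right₀ (by positivity),
        abs_mul] at hle
      rwa [← Complex.coe_algebraMap, aeval_algebraMap_apply, Complex.coe_algebraMap,
        Complex.norm_real]
    · rw [map_sub]
      exact le_max_of_le_left <|
        (norm_sub_le _ _).trans (add_le_add (hB z hz hne v) (hB z hz hne w))
  · simp only [hdiff]
    field_simp

end Pisot

section Golden

open Polynomial

lemma rho_pos : 0 < rho := inv_pos.2 Real.goldenRatio_pos

lemma rho_sq : rho ^ 2 = 1 - rho := by
  rw [rho, Real.inv_goldenRatio, neg_sq, Real.goldenConj_sq]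
  ring

lemma rho_lt_one : rho < 1 := by nlinarith [rho_sq, rho_pos]

lemma half_lt_rho : 1 / 2 < rho := by nlinarith [rho_sq, rho_pos]

lemma goldenIFS_zero (x : ℝ) : goldenIFS 0 x = rho * x := rfl

lemma goldenIFS_one (x : ℝ) : goldenIFS 1 x = rho * x + 1 - rho := rfl

lemma goldenIFS_apply (j : Fin 2) (x : ℝ) :
    goldenIFS j x = rho * x + (1 - rho) * ![0, 1] j := by
  fin_cases j
  · simp [goldenIFS_zero]
  · simp [goldenIFS_one, add_sub_assoc]

lemma dist_goldenIFS (j : Fin 2) (x y : ℝ) :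
    dist (goldenIFS j x) (goldenIFS j y) = rho * dist x y := by
  rw [goldenIFS_apply, goldenIFS_apply, dist_add_right, Real.dist_eq, Real.dist_eq, ← mul_sub,
    abs_mul, abs_of_pos rho_pos]

lemma wordMap_goldenIFS_replicate_zero (n : ℕ) (x : ℝ) :
    wordMap goldenIFS (List.replicate n 0) x = rho ^ n * x := by
  induction n with
  | zero => simp [wordMap]
  | succ n ih =>
    calc wordMap goldenIFS (List.replicate (n + 1) 0) x
        = rho * wordMap goldenIFS (List.replicate n 0) x := rfl
      _ = rho ^ (n + 1) * x := by rw [ih, pow_succ', mul_assoc]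

lemma image_goldenIFS_zero_Icc (a b : ℝ) :
    goldenIFS 0 '' Icc a b = Icc (rho * a) (rho * b) :=
  image_mul_left_Icc' rho_pos a b

lemma image_goldenIFS_one_Icc (a b : ℝ) :
    goldenIFS 1 '' Icc a b = Icc (rho * a + (1 - rho)) (rho * b + (1 - rho)) := by
  rw [← image_affine_Icc' rho_pos]
  exact image_congr fun x _ => by rw [goldenIFS_one, add_sub_assoc]

lemma isSelfSimilarSet_goldenIFS : IsSelfSimilarSet goldenIFS (Icc 0 1) := by
  have hoverlap : 1 - rho ≤ rho := by linarith [half_lt_rho]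
  refine ⟨nonempty_Icc.2 zero_le_one, isCompact_Icc, ?_⟩
  have hunion : ⋃ j, goldenIFS j '' Icc 0 1 = goldenIFS 0 '' Icc 0 1 ∪ goldenIFS 1 '' Icc 0 1 := by
    ext x
    simp only [mem_iUnion, Fin.exists_fin_two, mem_union]
  rw [hunion, image_goldenIFS_zero_Icc, image_goldenIFS_one_Icc, mul_zero, mul_one,
    zero_add, add_sub_cancel, Icc_union_Icc' hoverlap zero_le_one,
    min_eq_left (sub_nonneg.2 rho_lt_one.le), max_eq_right rho_lt_one.le]

lemma isPisot_goldenRatio : IsPisot Real.goldenRatio := by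
  have hroot : ∀ x : ℝ, x ^ 2 = x + 1 → aeval x (X ^ 2 - X - 1 : ℤ[X]) = 0 := by
    intro x hx
    simp [hx]
  have hint : IsIntegral ℤ Real.goldenRatio :=
    ⟨X ^ 2 - X - 1, by monicity!, hroot _ Real.goldenRatio_sq⟩
  refine ⟨Real.one_lt_goldenRatio, hint, fun z hz hne => ?_⟩
  have hquad : aeval z (X ^ 2 - X - 1 : ℤ[X]) = 0 :=
    aeval_eq_zero_of_dvd_aeval_eq_zero
      (minpoly.isIntegrallyClosed_dvd hint (hroot _ Real.goldenRatio_sq)) hz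
  have hfactor : (z - Real.goldenRatio) * (z - Real.goldenConj) = 0 := by
    have hsum : (Real.goldenRatio + Real.goldenConj : ℂ) = 1 :=
      mod_cast Real.goldenRatio_add_goldenConj
    have hprod : (Real.goldenRatio * Real.goldenConj : ℂ) = -1 :=
      mod_cast Real.goldenRatio_mul_goldenConj
    simp only [map_sub, map_pow, aeval_X, map_one] at hquad
    linear_combination hquad - z * hsum + hprod
  rw [sub_eq_zero.1 ((mul_eq_zero.1 hfactor).resolve_left (sub_ne_zero.2 hne)), Complex.norm_real,
    Real.norm_eq_abs, abs_of_neg Real.goldenConj_neg, ← Real.inv_goldenRatio]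
  exact rho_lt_one

lemma isFiniteType_goldenIFS : IsFiniteType goldenIFS rho := by
  refine isPisot_goldenRatio.isFiniteType (q := ![0, 1]) (sub_pos.2 rho_lt_one).ne' (fun j x => ?_)
    isSelfSimilarSet_goldenIFS
  rw [goldenIFS_apply, rho]
  fin_cases j <;> simp

lemma existsUnique_isSelfSimilarMeasure_goldenIFS {p : ℝ} (hp0 : 0 < p) (hp1 : p < 1) :
    ∃! μ, IsSelfSimilarMeasure goldenIFS (biasedProb p) μ :=
  existsUnique_isSelfSimilarMeasure
    (fun j => ⟨rho, ⟨rho_pos, rho_lt_one⟩, dist_goldenIFS j⟩)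
    (Fin.forall_fin_two.2 ⟨hp0, sub_pos.2 hp1⟩) (by simp [biasedProb])

namespace IsSelfSimilarMeasure

variable {p : ℝ} {μ : Measure ℝ}

lemma support_eq_Icc (h : IsSelfSimilarMeasure goldenIFS (biasedProb p) μ) :
    μ.support = Icc 0 1 :=
  h.support_eq isSelfSimilarSet_goldenIFS

lemma measureReal_le_add (h : IsSelfSimilarMeasure goldenIFS (biasedProb p) μ) {E A B : Set ℝ}
    (hE : MeasurableSet E) (hA : goldenIFS 0 ⁻¹' E ⊆ A) (hB : goldenIFS 1 ⁻¹' E ⊆ B) :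
    μ.real E ≤ p * μ.real A + (1 - p) * μ.real B := by
  simpa [Fin.sum_univ_two, biasedProb] using
    h.measureReal_le_sum (A := ![A, B]) hE (Fin.forall_fin_two.2 ⟨hA, hB⟩)

lemma le_measureReal_Icc_rho_sq (h : IsSelfSimilarMeasure goldenIFS (biasedProb p) μ) (n : ℕ) :
    (1 - p) * p ^ n ≤ μ.real (Icc (rho ^ 2) (rho ^ 2 + rho ^ (n + 1))) := by
  have hmaps : MapsTo (wordMap goldenIFS (1 :: List.replicate n 0)) (Icc 0 1)
      (Icc (rho ^ 2) (rho ^ 2 + rho ^ (n + 1))) := by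
    intro x hx
    have hx' : wordMap goldenIFS (1 :: List.replicate n 0) x = rho ^ 2 + rho ^ (n + 1) * x := by
      calc wordMap goldenIFS (1 :: List.replicate n 0) x
          = goldenIFS 1 (wordMap goldenIFS (List.replicate n 0) x) := rfl
        _ = rho ^ 2 + rho ^ (n + 1) * x := by
          rw [wordMap_goldenIFS_replicate_zero, goldenIFS_one, rho_sq]
          ring
    have hpow : 0 < rho ^ (n + 1) := pow_pos rho_pos _
    rw [hx']
    exact ⟨le_add_of_nonneg_right (mul_nonneg hpow.le hx.1),
      add_le_add_right (mul_le_of_le_one_right hpow.le hx.2) _⟩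
  simpa [biasedProb, h.measureReal_eq_one isSelfSimilarSet_goldenIFS] using
    h.prod_mul_measureReal_le measurableSet_Icc hmaps

lemma measureReal_Ioo_one_le (h : IsSelfSimilarMeasure goldenIFS (biasedProb p) μ) (n : ℕ) :
    μ.real (Ioo (1 - rho ^ (n + 1)) 1) ≤ (1 - p) ^ n := by
  have := h.isProbabilityMeasure
  have hρ := rho_pos
  induction n with
  | zero => simp
  | succ n ih =>
    have hzero : goldenIFS 0 ⁻¹' Ioo (1 - rho ^ (n + 2)) 1 ⊆ Ioi 1 := by
      intro x hx
      have hn : rho ^ (n + 2) ≤ rho ^ 2 :=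
        pow_le_pow_of_le_one hρ.le rho_lt_one.le (Nat.le_add_left 2 n)
      refine (lt_mul_iff_one_lt_right hρ).1 ?_
      rw [← goldenIFS_zero]
      linarith [hx.1, rho_sq]
    have hone : goldenIFS 1 ⁻¹' Ioo (1 - rho ^ (n + 2)) 1 ⊆ Ioo (1 - rho ^ (n + 1)) 1 := by
      intro x hx
      rw [mem_preimage, goldenIFS_one, pow_succ' _ (n + 1)] at hx
      constructor <;> nlinarith [hx.1, hx.2]
    have hright : Disjoint (Ioi 1) (Icc (0 : ℝ) 1) :=
      disjoint_left.2 fun _ hx hx' => hx'.2.not_gt hx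
    calc μ.real (Ioo (1 - rho ^ (n + 2)) 1)
        ≤ p * μ.real (Ioi 1) + (1 - p) * μ.real (Ioo (1 - rho ^ (n + 1)) 1) :=
          h.measureReal_le_add measurableSet_Ioo hzero hone
      _ = (1 - p) * μ.real (Ioo (1 - rho ^ (n + 1)) 1) := by
          rw [h.measureReal_eq_zero isSelfSimilarSet_goldenIFS hright, mul_zero, zero_add]
      _ ≤ (1 - p) ^ (n + 1) := by
          rw [pow_succ' (1 - p)]
          exact mul_le_mul_of_nonneg_left ih (h.prob_pos 1).le

lemma measureReal_Ioo_rho_sq_le (h : IsSelfSimilarMeasure goldenIFS (biasedProb p) μ) (n : ℕ) :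
    μ.real (Ioo (rho ^ 2 - rho ^ (n + 2)) (rho ^ 2)) ≤
      p * μ.real (Ioo (rho - rho ^ (n + 1)) rho) := by
  have hρ := rho_pos
  have hzero : goldenIFS 0 ⁻¹' Ioo (rho ^ 2 - rho ^ (n + 2)) (rho ^ 2)
      ⊆ Ioo (rho - rho ^ (n + 1)) rho := by
    intro x hx
    rw [mem_preimage, goldenIFS_zero, pow_succ' _ (n + 1)] at hx
    constructor <;> nlinarith [hx.1, hx.2]
  have hone : goldenIFS 1 ⁻¹' Ioo (rho ^ 2 - rho ^ (n + 2)) (rho ^ 2) ⊆ Iio 0 := by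
    intro x hx
    rw [mem_preimage, goldenIFS_one, rho_sq, add_sub_assoc] at hx
    exact lt_of_mul_lt_mul_left (by linarith [hx.2]) hρ.le
  have hleft : Disjoint (Iio 0) (Icc (0 : ℝ) 1) :=
    disjoint_left.2 fun _ hx hx' => hx'.1.not_gt hx
  calc μ.real (Ioo (rho ^ 2 - rho ^ (n + 2)) (rho ^ 2))
      ≤ p * μ.real (Ioo (rho - rho ^ (n + 1)) rho) + (1 - p) * μ.real (Iio 0) :=
        h.measureReal_le_add measurableSet_Ioo hzero hone
    _ = p * μ.real (Ioo (rho - rho ^ (n + 1)) rho) := by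
        rw [h.measureReal_eq_zero isSelfSimilarSet_goldenIFS hleft, mul_zero, add_zero]

lemma measureReal_Ioo_rho_le (h : IsSelfSimilarMeasure goldenIFS (biasedProb p) μ) (n : ℕ) :
    μ.real (Ioo (rho - rho ^ (n + 1)) rho) ≤
      p * μ.real (Ioo (1 - rho ^ n) 1) + (1 - p) * μ.real (Ioo (rho ^ 2 - rho ^ n) (rho ^ 2)) := by
  have hρ := rho_pos
  refine h.measureReal_le_add measurableSet_Ioo (fun x hx => ?_) (fun x hx => ?_)
  · rw [mem_preimage, goldenIFS_zero, pow_succ'] at hx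
    constructor <;> nlinarith [hx.1, hx.2]
  · rw [mem_preimage, goldenIFS_one, pow_succ' _ n] at hx
    constructor <;> nlinarith [hx.1, hx.2, rho_sq]

lemma exists_measureReal_Ioo_rho_sq_le (h : IsSelfSimilarMeasure goldenIFS (biasedProb p) μ)
    (hp : 1 / 2 < p) : ∃ C > 0, ∀ m : ℕ,
      μ.real (Ioo (rho ^ 2 - rho ^ (2 * m + 1)) (rho ^ 2)) ≤ C * (p * (1 - p)) ^ m := by
  have : 0 < p := h.prob_pos 0
  have hq : 0 < 1 - p := h.prob_pos 1
  have hlt : (1 - p) ^ 2 < p * (1 - p) := by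
    rw [sq]
    exact mul_lt_mul_of_pos_right (by linarith) hq
  set u : ℕ → ℝ := fun m => μ.real (Ioo (rho ^ 2 - rho ^ (2 * m + 1)) (rho ^ 2))
  have hrec : ∀ m, u (m + 1) ≤ p ^ 2 * ((1 - p) ^ 2) ^ m + p * (1 - p) * u m := fun m =>
    calc u (m + 1)
        ≤ p * μ.real (Ioo (rho - rho ^ (2 * m + 1 + 1)) rho) :=
          h.measureReal_Ioo_rho_sq_le (2 * m + 1)
      _ ≤ p * (p * (1 - p) ^ (2 * m) + (1 - p) * u m) := by
          gcongr
          refine (h.measureReal_Ioo_rho_le (2 * m + 1)).trans ?_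
          gcongr
          exact h.measureReal_Ioo_one_le (2 * m)
      _ = p ^ 2 * ((1 - p) ^ 2) ^ m + p * (1 - p) * u m := by
          rw [pow_mul]
          ring
  exact ⟨u 0 + p ^ 2 / (p * (1 - p) - (1 - p) ^ 2),
    add_pos_of_nonneg_of_pos measureReal_nonneg (div_pos (by positivity) (sub_pos.2 hlt)),
    le_mul_pow_of_succ_le (by positivity) (by positivity) hlt hrec⟩

lemma exists_mul_pow_mul_measureReal_ball_le
    (h : IsSelfSimilarMeasure goldenIFS (biasedProb p) μ) (hp : 1 / 2 < p) :
    ∃ c > 0, ∀ m : ℕ,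
      c * (p / (1 - p)) ^ m *
          μ.real (Metric.ball (rho ^ 2 - rho ^ (2 * m + 1) / 2) (rho / 2 * (rho ^ 2) ^ m)) ≤
        μ.real (Metric.ball (rho ^ 2 - rho ^ (2 * m + 1) / 2) (2 * rho * (rho ^ 2) ^ m)) := by
  have := h.isProbabilityMeasure
  have : 0 < p := h.prob_pos 0
  have : 0 < 1 - p := h.prob_pos 1
  obtain ⟨C, hC, hleft⟩ := h.exists_measureReal_Ioo_rho_sq_le hp
  refine ⟨(1 - p) / C, by positivity, fun m => ?_⟩
  have hε : 0 < rho ^ (2 * m + 1) := pow_pos rho_pos _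
  have hsmall : Metric.ball (rho ^ 2 - rho ^ (2 * m + 1) / 2) (rho / 2 * (rho ^ 2) ^ m)
      = Ioo (rho ^ 2 - rho ^ (2 * m + 1)) (rho ^ 2) := by
    rw [Real.ball_eq_Ioo]
    congr 1 <;> ring
  have hbig : Icc (rho ^ 2) (rho ^ 2 + rho ^ (2 * m + 1))
      ⊆ Metric.ball (rho ^ 2 - rho ^ (2 * m + 1) / 2) (2 * rho * (rho ^ 2) ^ m) := by
    have hR : 2 * rho * (rho ^ 2) ^ m = 2 * rho ^ (2 * m + 1) := by ring
    rw [Real.ball_eq_Ioo, hR]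
    exact Icc_subset_Ioo (by linarith) (by linarith)
  calc (1 - p) / C * (p / (1 - p)) ^ m * μ.real (Metric.ball _ _)
      ≤ (1 - p) / C * (p / (1 - p)) ^ m * (C * (p * (1 - p)) ^ m) := by
        rw [hsmall]
        gcongr
        exact hleft m
    _ = (1 - p) * p ^ (2 * m) := by
        rw [div_pow, mul_pow, pow_mul, sq, mul_pow]
        field_simp
    _ ≤ μ.real (Metric.ball _ _) :=
        (h.le_measureReal_Icc_rho_sq (2 * m)).trans (measureReal_mono hbig)

theorem log_div_le_upperPhiDim (h : IsSelfSimilarMeasure goldenIFS (biasedProb p) μ)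
    (hp : 1 / 2 < p) {δ : ℝ} (hδ : 0 < δ) :
    ((Real.log (p / (1 - p)) / (2 * δ * |Real.log rho|) : ℝ) : EReal) ≤
      upperPhiDim (fun _ => δ) μ := by
  have := h.isProbabilityMeasure
  have hρ := rho_pos
  have hρ1 := rho_lt_one
  obtain ⟨c, hc, hratio⟩ := h.exists_mul_pow_mul_measureReal_ball_le hp
  have hsupp : ∀ m : ℕ, rho ^ 2 - rho ^ (2 * m + 1) / 2 ∈ μ.support := by
    intro m
    have hε : 0 < rho ^ (2 * m + 1) := pow_pos hρ _
    have hερ : rho ^ (2 * m + 1) ≤ rho := pow_le_of_le_one hρ.le hρ1.le (Nat.succ_ne_zero _)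
    rw [h.support_eq_Icc]
    constructor <;> nlinarith [half_lt_rho]
  have hlog : δ * |Real.log (rho ^ 2)| = 2 * δ * |Real.log rho| := by
    rw [Real.log_pow, Nat.cast_ofNat, abs_mul, abs_two]
    ring
  rw [← hlog]
  exact log_div_le_upperPhiDim_const (by positivity) (by positivity)
    ⟨by positivity, pow_lt_one₀ hρ.le hρ1 two_ne_zero⟩ hδ hc
    (div_pos (h.prob_pos 0) (h.prob_pos 1)) hsupp hratio

theorem hasQuasiAssouadDim_top (h : IsSelfSimilarMeasure goldenIFS (biasedProb p) μ)
    (hp : 1 / 2 < p) : HasQuasiAssouadDim μ ⊤ := by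
  have hq : 0 < 1 - p := h.prob_pos 1
  have hodds : 1 < p / (1 - p) := (one_lt_div hq).2 (by linarith)
  have hlog : Real.log rho ≠ 0 := (Real.log_neg rho_pos rho_lt_one).ne
  refine hasQuasiAssouadDim_top_of_div_le (L := Real.log (p / (1 - p)) / (2 * |Real.log rho|))
    (div_pos (Real.log_pos hodds) (by positivity)) fun δ hδ => ?_
  rw [div_div, mul_right_comm]
  exact h.log_div_le_upperPhiDim hp hδ

end IsSelfSimilarMeasure

end Golden

end BernoulliConv

open BernoulliConv in
theorem mainTheorem7 (p : ℝ) (hp : 1 / 2 < p) (hp1 : p < 1) :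
    (∃! μ : Measure ℝ, IsSelfSimilarMeasure goldenIFS (biasedProb p) μ) ∧
    ∀ μ : Measure ℝ, IsSelfSimilarMeasure goldenIFS (biasedProb p) μ →
      IsEquicontractive goldenIFS rho ∧
      IsFiniteType goldenIFS rho ∧
      μ.support = Icc (0 : ℝ) 1 ∧
      (∀ δ : ℝ, 0 < δ →
        ((Real.log (p / (1 - p)) / (2 * δ * |Real.log rho|) : ℝ) : EReal)
            ≤ upperPhiDim (fun _ => δ) μ ∧
          upperPhiDim (fun _ => δ) μ < ⊤) ∧
      HasQuasiAssouadDim μ ⊤ :=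
  ⟨existsUnique_isSelfSimilarMeasure_goldenIFS (one_half_pos.trans hp) hp1, fun _μ h =>
    ⟨isFiniteType_goldenIFS.1, isFiniteType_goldenIFS, h.support_eq_Icc,
      fun _δ hδ => ⟨h.log_div_le_upperPhiDim hp hδ,
        h.upperPhiDim_const_lt_top isSelfSimilarSet_goldenIFS hδ⟩,
      h.hasQuasiAssouadDim_top hp⟩⟩
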